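/- Let $F$ be a probability distribution concentrated on $(0,1)$, let $w_1,w_2,\dots$ be i.i.d. random variables with law $F$, and let $x_1,x_2,\dots$ be $\{0,1\}$-valued random variables that, conditionally on $(w_i)_{i\ge1}$, are mutually independent with $x_i\sim\mathrm{Bernoulli}(w_i)$. For $m\ge 1$ put $s_m=\sum_{i=1}^m x_i$, $\delta_m=\sum_{i=1}^m(1-x_i)w_i$, and for $h>0$ and $\tau\in[0,1]$ $$\Phi_m(\tau;h)=h\,\delta_m\,\tau^{h\delta_m-1}\prod_{i=1}^m\bigl(1-\tau^{h w_i}\bigr)^{x_i},\qquad z_m(h)=\delta_m-\frac1h-\sum_{i=1}^m\frac{x_iw_i}{2^{hw_i}-1}.$$ Then, almost surely, the following hold. 1. $\delta_m>0$ and $s_m>0$ for all sufficiently large $m$. 2. For every $m$ with $\delta_m>0$, one has $z_m(h)=\frac{1}{2h}\,\frac{\partial}{\partial\tau}\log\Phi_m(\tau;h)\big|_{\tau=1/2}$ for all $h>0$, and $z_m$ has a unique root $h_m$ in $[1/\delta_m,\infty)$. Put $\Phi_m(\tau)=\Phi_m(\tau;h_m)$ and $\phi_m=\log\Phi_m$ (the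 choice of $h_m$ for the finitely many $m$ with $\delta_m=0$ is irrelevant). 3. For every $m$ with $\delta_m>0$ and $s_m>0$, the function $\Phi_m$ on $[0,1]$ attains its maximum at $\tau=1/2$ and nowhere else. 4. For every $\epsilon_0>0$ and $M>0$ and every sequence of functions $f_m\in C^1(0,1)$ with $f_m(1/2)>\epsilon_0$ and $|f_m'(t)|\le M$ for all $t\in(0,1)$ and all $m$, $$\int_0^1 f_m(\tau)\Phi_m(\tau)\,d\tau\;\sim\; f_m\!\left(\tfrac12\right)\Phi_m\!\left(\tfrac12\right)\sqrt{\frac{-2\pi}{\phi_m''(1/2)}}\qquad(m\to\infty),$$ that is, the ratio of the two sides tends to $1$. (The exceptional null event does not depend on the sequence $(f_m)$.) -/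

import Mathlib

open MeasureTheory ProbabilityTheory Filter Topology Set

namespace BiasedSampling

/-- The probabilistic model: `w 0, w 1, …` are i.i.d. with law `F`, and, conditionally on the whole
sequence of weights, `x 0, x 1, …` are mutually independent with `x i ∼ Bernoulli (w i)`. The last
field is the conditional joint law of every finite family of the indicators given
`σ(w 0, w 1, …)`. -/
structure IsBernoulliModel {Ω : Type*} [MeasurableSpace Ω] (P : Measure Ω) (F : Measure ℝ)
    (w : ℕ → Ω → ℝ) (x : ℕ → Ω → ℕ) : Prop where
  measurable_w : ∀ i, Measurable (w i)
  measurable_x : ∀ i, Measurable (x i)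
  law_w : ∀ i, P.map (w i) = F
  indep_w : iIndepFun w P
  x_zero_or_one : ∀ i, ∀ᵐ ω ∂P, x i ω = 0 ∨ x i ω = 1
  cond_law_x : ∀ (s : Finset ℕ) (b : ℕ → ℕ), (∀ i, b i = 0 ∨ b i = 1) →
    P[({ω | ∀ i ∈ s, x i ω = b i}.indicator fun _ => (1 : ℝ)) |
        ⨆ i, MeasurableSpace.comap (w i) inferInstance]
      =ᵐ[P] fun ω => ∏ i ∈ s, (if b i = 1 then w i ω else 1 - w i ω)

/-! The following are deterministic functions of a realisation `w : ℕ → ℝ`, `x : ℕ → ℕ` of the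
weights and the indicators, whose first `m` terms are those with index `i < m`. -/

/-- `s_m = ∑ x_i`, the number of successes. -/
def successes (x : ℕ → ℕ) (m : ℕ) : ℕ := ∑ i ∈ Finset.range m, x i

/-- `δ_m = ∑ (1 - x_i) w_i`. -/
noncomputable def delta (w : ℕ → ℝ) (x : ℕ → ℕ) (m : ℕ) : ℝ :=
  ∑ i ∈ Finset.range m, (1 - (x i : ℝ)) * w i

/-- `h δ_m τ ^ (h δ_m - 1) ∏ (1 - τ ^ (h w_i)) ^ x_i`, for a general scaling parameter `h`. -/
noncomputable def PhiWith (w : ℕ → ℝ) (x : ℕ → ℕ) (m : ℕ) (h τ : ℝ) : ℝ :=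
  h * delta w x m * τ ^ (h * delta w x m - 1) *
    ∏ i ∈ Finset.range m, (1 - τ ^ (h * w i)) ^ x i

/-- `z(h) = δ_m - 1 / h - ∑ x_i w_i / (2 ^ (h w_i) - 1)`. -/
noncomputable def zFun (w : ℕ → ℝ) (x : ℕ → ℕ) (m : ℕ) (h : ℝ) : ℝ :=
  delta w x m - 1 / h -
    ∑ i ∈ Finset.range m, (x i : ℝ) * w i / ((2 : ℝ) ^ (h * w i) - 1)

/-- `h` is a root of `z` in the interval `[1 / δ_m, ∞)`. -/
def IsScalingRoot (w : ℕ → ℝ) (x : ℕ → ℕ) (m : ℕ) (h : ℝ) : Prop :=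
  h ∈ Ici (1 / delta w x m) ∧ zFun w x m h = 0

/-- `h_m`: the root of `z` in `[1 / δ_m, ∞)`, and an arbitrary real number if there is no root. -/
noncomputable def scaling (w : ℕ → ℝ) (x : ℕ → ℕ) (m : ℕ) : ℝ :=
  Classical.epsilon (IsScalingRoot w x m)

/-- `Φ_m(τ)`, with the scaling parameter `h_m`. -/
noncomputable def Phi (w : ℕ → ℝ) (x : ℕ → ℕ) (m : ℕ) (τ : ℝ) : ℝ :=
  PhiWith w x m (scaling w x m) τ

/-- `φ_m = log Φ_m`. -/
noncomputable def phi (w : ℕ → ℝ) (x : ℕ → ℕ) (m : ℕ) (τ : ℝ) : ℝ :=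
  Real.log (Phi w x m τ)

/-- `f_m(1/2) Φ_m(1/2) √(-2π / φ_m''(1/2))`, the Laplace approximation of `∫₀¹ f_m Φ_m`. -/
noncomputable def laplaceApprox (w : ℕ → ℝ) (x : ℕ → ℕ) (f : ℕ → ℝ → ℝ) (m : ℕ) : ℝ :=
  f m (1 / 2) * Phi w x m (1 / 2) *
    Real.sqrt (-2 * Real.pi / iteratedDeriv 2 (phi w x m) (1 / 2))

end BiasedSampling

/-! ### Taylor's formula and one-variable estimates for log (1 - e^{-av}). -/

namespace BiasedSampling

/-! Put v = -log τ. Then log Φ_m is affine in v plus ∑ x_i log (1 - e^{-a_i v}), where a_i = h_m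
w_i. The equation z_m(h_m) = 0 says that the derivative at v = log 2 vanishes, so the affine part
cancels the tangents of the summands there: log Φ_m(τ) - log Φ_m(1/2) is the x_i-weighted sum of the
gaps between the concave functions log (1 - e^{-a_i v}) and their tangents at log 2
(`PhiWith_eq_mul_exp`). Strict concavity makes 1/2 the only maximiser.

The asymptotics need control that is uniform in the a_i. If all a_i ≤ C, the curvature of each
summand changes between log 2 and v by at most a factor depending only on C and v
(`curvature_growth`). Hence one number, the total curvature S_m at log 2, governs the whole sum:
globally log Φ_m(τ) - log Φ_m(1/2) ≤ -const · S_m (τ - 1/2)² (`sum_tangentGap_le`), and locally the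
sum is -S_m (v - log 2)² / 2 up to a relative error that vanishes as v → log 2
(`abs_sum_tangentGap_add_le`). Rescaling τ = 1/2 + t / √V_m with V_m = 4 S_m = -φ_m''(1/2),
dominated convergence yields the Gaussian integral (`tendsto_sqrt_mul_integral`).

What remains is that h_m stays bounded and S_m → ∞. Both follow from h_m ≤ (1 + s_m / log 2) / δ_m
and the linear growth of s_m and δ_m, which the strong law supplies almost surely
(`IsBernoulliModel.ae_linear_growth`). Everything after that is deterministic, so the null event
does not depend on (f_m). -/

/-- Second-order Taylor formula with Lagrange remainder, on either side of the base point. -/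
theorem exists_taylor_two {s : Set ℝ} (hs : OrdConnected s) {f f' f'' : ℝ → ℝ}
    (hf : ∀ y ∈ s, HasDerivAt f (f' y) y) (hf' : ∀ y ∈ s, HasDerivAt f' (f'' y) y)
    {c v : ℝ} (hc : c ∈ s) (hv : v ∈ s) :
    ∃ ξ ∈ uIcc c v, f v = f c + f' c * (v - c) + f'' ξ * (v - c) ^ 2 / 2 := by
  have hF : ∀ y ∈ s, HasDerivAt (fun y => f y - f' c * (y - c)) (f' y - f' c) y := fun y hy => by
    simpa using (hf y hy).fun_sub (((hasDerivAt_id' y).sub_const c).const_mul (f' c))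
  have hG : ∀ y, HasDerivAt (fun y : ℝ => (y - c) ^ 2) (2 * (y - c)) y := fun y => by
    simpa using ((hasDerivAt_id' y).sub_const c).fun_pow 2
  rcases lt_trichotomy c v with h | rfl | h
  · have hsub : Icc c v ⊆ s := hs.out hc hv
    -- Cauchy's mean value theorem against (y - c)², then the mean value theorem for f'; no
    -- continuity of f'' is needed.
    obtain ⟨y, hy, hy'⟩ := exists_ratio_hasDerivAt_eq_ratio_slope _ _ h
      (fun z hz => (hF z (hsub hz)).continuousAt.continuousWithinAt)
      (fun z hz => hF z (hsub (Ioo_subset_Icc_self hz))) _ _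
      (fun z _ => (hG z).continuousAt.continuousWithinAt) (fun z _ => hG z)
    obtain ⟨ξ, hξ, hξ'⟩ := exists_hasDerivAt_eq_slope f' f'' hy.1
      (fun z hz => (hf' z (hsub ⟨hz.1, hz.2.trans hy.2.le⟩)).continuousAt.continuousWithinAt)
      (fun z hz => hf' z (hsub ⟨hz.1.le, hz.2.le.trans hy.2.le⟩))
    refine ⟨ξ, by rw [uIcc_of_le h.le]; exact ⟨hξ.1.le, hξ.2.le.trans hy.2.le⟩, ?_⟩
    have h0 : y - c ≠ 0 := (sub_pos.2 hy.1).ne'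
    rw [eq_div_iff h0] at hξ'
    rw [← hξ'] at hy'
    apply mul_right_cancel₀ h0
    linear_combination (-1 / 2) * hy'
  · exact ⟨c, by simp, by simp⟩
  · have hsub : Icc v c ⊆ s := hs.out hv hc
    obtain ⟨y, hy, hy'⟩ := exists_ratio_hasDerivAt_eq_ratio_slope _ _ h
      (fun z hz => (hF z (hsub hz)).continuousAt.continuousWithinAt)
      (fun z hz => hF z (hsub (Ioo_subset_Icc_self hz))) _ _
      (fun z _ => (hG z).continuousAt.continuousWithinAt) (fun z _ => hG z)
    obtain ⟨ξ, hξ, hξ'⟩ := exists_hasDerivAt_eq_slope f' f'' hy.2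
      (fun z hz => (hf' z (hsub ⟨hy.1.le.trans hz.1, hz.2⟩)).continuousAt.continuousWithinAt)
      (fun z hz => hf' z (hsub ⟨hy.1.le.trans hz.1.le, hz.2.le⟩))
    refine ⟨ξ, by rw [uIcc_of_ge h.le]; exact ⟨hy.1.le.trans hξ.1.le, hξ.2.le⟩, ?_⟩
    have h0 : c - y ≠ 0 := (sub_pos.2 hy.2).ne'
    rw [eq_div_iff h0] at hξ'
    have h1 : f' y - f' c = - (f'' ξ * (c - y)) := by rw [hξ']; ring
    rw [h1] at hy'
    apply mul_right_cancel₀ h0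
    linear_combination (-1 / 2) * hy'

/-- `log (1 - e^{-av})`. -/
noncomputable def logTerm (a v : ℝ) : ℝ := Real.log (1 - Real.exp (-(a * v)))

/-- The derivative of `logTerm a`. -/
noncomputable def logTermDeriv (a v : ℝ) : ℝ := a / (Real.exp (a * v) - 1)

/-- Minus the second derivative of `logTerm a`. -/
noncomputable def curvature (a v : ℝ) : ℝ :=
  a ^ 2 * Real.exp (-(a * v)) / (1 - Real.exp (-(a * v))) ^ 2

theorem one_sub_exp_neg_pos {a v : ℝ} (ha : 0 < a) (hv : 0 < v) :
    0 < 1 - Real.exp (-(a * v)) := by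
  have : Real.exp (-(a * v)) < 1 := by simpa using mul_pos ha hv
  linarith

theorem exp_sub_one_pos {a v : ℝ} (ha : 0 < a) (hv : 0 < v) : 0 < Real.exp (a * v) - 1 :=
  sub_pos.2 (Real.one_lt_exp_iff.2 (mul_pos ha hv))

theorem curvature_pos {a v : ℝ} (ha : 0 < a) (hv : 0 < v) : 0 < curvature a v := by
  have := one_sub_exp_neg_pos ha hv
  unfold curvature; positivity

theorem hasDerivAt_logTerm {a v : ℝ} (ha : 0 < a) (hv : 0 < v) :
    HasDerivAt (logTerm a) (logTermDeriv a v) v := by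
  have h1 := one_sub_exp_neg_pos ha hv
  have h2 := exp_sub_one_pos ha hv
  have h : HasDerivAt (fun v => 1 - Real.exp (-(a * v))) (a * Real.exp (-(a * v))) v := by
    have := (((hasDerivAt_id' v).const_mul a).fun_neg.exp).const_sub 1
    exact this.congr_deriv (by ring)
  refine (h.log h1.ne').congr_deriv ?_
  symm
  unfold logTermDeriv
  rw [div_eq_div_iff h2.ne' h1.ne', Real.exp_neg]
  field_simp

theorem hasDerivAt_logTermDeriv {a v : ℝ} (ha : 0 < a) (hv : 0 < v) :
    HasDerivAt (logTermDeriv a) (-curvature a v) v := by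
  have h1 := one_sub_exp_neg_pos ha hv
  have h2 := exp_sub_one_pos ha hv
  have h : HasDerivAt (fun v => Real.exp (a * v) - 1) (Real.exp (a * v) * a) v := by
    have := (((hasDerivAt_id' v).const_mul a).exp).sub_const 1
    exact this.congr_deriv (by ring)
  refine ((hasDerivAt_const v a).fun_div h h2.ne').congr_deriv ?_
  unfold curvature
  rw [Real.exp_neg] at h1 ⊢
  have h3 : Real.exp (a * v) ≠ 0 := (Real.exp_pos _).ne'
  have h4 : 1 - (Real.exp (a * v))⁻¹ = (Real.exp (a * v) - 1) / Real.exp (a * v) := by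
    field_simp
  rw [h4]
  field_simp
  ring

theorem curvature_antitone {a u v : ℝ} (ha : 0 < a) (hu : 0 < u) (huv : u ≤ v) :
    curvature a v ≤ curvature a u := by
  have h1 := one_sub_exp_neg_pos ha hu
  have h : Real.exp (-(a * v)) ≤ Real.exp (-(a * u)) := by gcongr
  unfold curvature
  gcongr

/-- From 1 - e^{-av} ≤ av. The bound does not degenerate as a → 0, so arbitrarily small weights
still contribute a fixed amount of curvature. -/
theorem le_curvature {a C v : ℝ} (ha : 0 < a) (haC : a ≤ C) (hv : 0 < v) :
    Real.exp (-(C * v)) / v ^ 2 ≤ curvature a v := by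
  have h1 := one_sub_exp_neg_pos ha hv
  have h2 : 1 - Real.exp (-(a * v)) ≤ a * v := by linarith [Real.add_one_le_exp (-(a * v))]
  calc Real.exp (-(C * v)) / v ^ 2 ≤ Real.exp (-(a * v)) / v ^ 2 := by gcongr
    _ = a ^ 2 * Real.exp (-(a * v)) / (a * v) ^ 2 := by field_simp
    _ ≤ _ := by unfold curvature; gcongr

/-- By convexity of exp, (1 - e^{-av}) / v decreases in v, which costs the factor (u / v)²; the
numerator costs e^{-a(v-u)} ≥ e^{-C(v-u)}. The loss is uniform over a ≤ C. -/
theorem curvature_growth {a C u v : ℝ} (ha : 0 < a) (haC : a ≤ C) (hu : 0 < u) (huv : u ≤ v) :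
    curvature a u * (Real.exp (-(C * (v - u))) * (u / v) ^ 2) ≤ curvature a v := by
  have hv := hu.trans_le huv
  have h1 := one_sub_exp_neg_pos ha hu
  have h2 := one_sub_exp_neg_pos ha hv
  have key : u * (1 - Real.exp (-(a * v))) ≤ v * (1 - Real.exp (-(a * u))) := by
    have := convexOn_exp.2 (mem_univ (-(a * v))) (mem_univ 0)
      (show 0 ≤ u / v by positivity) (sub_nonneg.2 ((div_le_one hv).2 huv)) (by ring)
    have e : (u / v) • (-(a * v)) + (1 - u / v) • (0 : ℝ) = -(a * u) := by
      simp only [smul_eq_mul]; field_simp; ring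
    rw [e] at this
    simp only [smul_eq_mul, Real.exp_zero] at this
    have h3 := mul_le_mul_of_nonneg_left this hv.le
    have e2 : v * (u / v * Real.exp (-(a * v)) + (1 - u / v) * 1)
      = u * Real.exp (-(a * v)) + v - u := by field_simp; ring
    rw [e2] at h3
    linarith
  have hexp : Real.exp (-(a * u)) * Real.exp (-(C * (v - u))) ≤ Real.exp (-(a * v)) := by
    rw [← Real.exp_add]
    gcongr
    nlinarith
  have hfr : u / v / (1 - Real.exp (-(a * u))) ≤ 1 / (1 - Real.exp (-(a * v))) := by
    rw [div_div, div_le_div_iff₀ (by positivity) h2]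
    linarith
  calc _ = a ^ 2 * (Real.exp (-(a * u)) * Real.exp (-(C * (v - u))))
        * (u / v / (1 - Real.exp (-(a * u)))) ^ 2 := by unfold curvature; field_simp
    _ ≤ a ^ 2 * Real.exp (-(a * v)) * (1 / (1 - Real.exp (-(a * v)))) ^ 2 := by gcongr
    _ = _ := by unfold curvature; field_simp

/-- `logTerm a` minus its tangent at `log 2`. -/
noncomputable def tangentGap (a v : ℝ) : ℝ :=
  logTerm a v - logTerm a (Real.log 2) - (v - Real.log 2) * logTermDeriv a (Real.log 2)

/-- The distortion factor `e^{-C(v - log 2)} (log 2 / v)²` of the curvature. -/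
noncomputable def distortion (C v : ℝ) : ℝ :=
  Real.exp (-(C * (v - Real.log 2))) * (Real.log 2 / v) ^ 2

theorem log_two_pos : 0 < Real.log 2 := Real.log_pos one_lt_two

theorem distortion_pos {C v : ℝ} (hv : 0 < v) : 0 < distortion C v := by
  have := log_two_pos
  unfold distortion; positivity

theorem distortion_antitone {C u v : ℝ} (hC : 0 ≤ C) (hu : 0 < u) (huv : u ≤ v) :
    distortion C v ≤ distortion C u := by
  have := log_two_pos
  have := hu.trans_le huv
  unfold distortion
  gcongr

theorem exists_tangentGap_eq {a v : ℝ} (ha : 0 < a) (hv : 0 < v) :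
    ∃ ξ ∈ uIcc (Real.log 2) v, tangentGap a v = -(curvature a ξ * ((v - Real.log 2) ^ 2 / 2)) := by
  obtain ⟨ξ, hξ, h⟩ := exists_taylor_two (s := Ioi 0) ordConnected_Ioi
    (fun y hy => hasDerivAt_logTerm ha hy) (fun y hy => hasDerivAt_logTermDeriv ha hy)
    (c := Real.log 2) (v := v) log_two_pos hv
  refine ⟨ξ, hξ, ?_⟩
  unfold tangentGap
  rw [h]; ring

theorem tangentGap_le_of_le {a v : ℝ} (ha : 0 < a) (hv : 0 < v) (h : v ≤ Real.log 2) :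
    tangentGap a v ≤ -(curvature a (Real.log 2) * ((v - Real.log 2) ^ 2 / 2)) := by
  obtain ⟨ξ, hξ, e⟩ := exists_tangentGap_eq ha hv
  rw [uIcc_of_ge h] at hξ
  rw [e]
  have := curvature_antitone ha (hv.trans_le hξ.1) hξ.2
  gcongr

theorem tangentGap_le_of_ge {a C v : ℝ} (ha : 0 < a) (haC : a ≤ C) (h : Real.log 2 ≤ v) :
    tangentGap a v
      ≤ -(curvature a (Real.log 2) * distortion C v * ((v - Real.log 2) ^ 2 / 2)) := by
  obtain ⟨ξ, hξ, e⟩ := exists_tangentGap_eq ha (log_two_pos.trans_le h)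
  rw [uIcc_of_le h] at hξ
  rw [e]
  have h0 := log_two_pos.trans_le hξ.1
  have h1 := curvature_growth ha haC log_two_pos hξ.1
  have h2 := mul_le_mul_of_nonneg_left (distortion_antitone (ha.le.trans haC) h0 hξ.2)
    (curvature_pos ha log_two_pos).le
  have := h2.trans h1
  gcongr

/-- The Taylor remainder has curvature at some ξ between log 2 and v. This lies between the
curvature at log 2 and its multiple by `distortion C v`, on whichever side of log 2 the point v is.
-/
theorem abs_tangentGap_add_le {a C v : ℝ} (ha : 0 < a) (haC : a ≤ C) (hv : 0 < v) :
    |tangentGap a v + curvature a (Real.log 2) * ((v - Real.log 2) ^ 2 / 2)|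
      ≤ curvature a (Real.log 2) * (|distortion C v - 1| * ((v - Real.log 2) ^ 2 / 2)) := by
  obtain ⟨ξ, hξ, e⟩ := exists_tangentGap_eq ha hv
  have hk := curvature_pos ha log_two_pos
  have hC := ha.le.trans haC
  have key : |curvature a (Real.log 2) - curvature a ξ|
      ≤ curvature a (Real.log 2) * |distortion C v - 1| := by
    rcases le_total (Real.log 2) v with h | h
    · rw [uIcc_of_le h] at hξ
      have h0 := log_two_pos.trans_le hξ.1
      have h1 := curvature_growth ha haC log_two_pos hξ.1
      have h2 := mul_le_mul_of_nonneg_left (distortion_antitone hC h0 hξ.2) hk.le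
      have h3 := curvature_antitone ha log_two_pos hξ.1
      have h4 : curvature a (Real.log 2) * distortion C ξ ≤ curvature a ξ := h1
      rw [abs_of_nonneg (by linarith)]
      have h5 := mul_le_mul_of_nonneg_left (neg_abs_le (distortion C v - 1)) hk.le
      linarith
    · rw [uIcc_of_ge h] at hξ
      have h0 := hv.trans_le hξ.1
      have h1 := curvature_growth ha haC h0 hξ.2
      have h2 := mul_le_mul_of_nonneg_left (distortion_antitone hC hv hξ.1) hk.le
      have h3 := curvature_antitone ha h0 hξ.2
      have h4 : curvature a ξ ≤ curvature a (Real.log 2) * distortion C ξ := by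
        -- Left of log 2, `curvature_growth` runs from ξ to log 2; its factor is the reciprocal of
        -- the distortion at ξ.
        have e1 : (Real.exp (-(C * (Real.log 2 - ξ))) * (ξ / Real.log 2) ^ 2)
            * distortion C ξ = 1 := by
          have := log_two_pos
          unfold distortion
          have e2 : Real.exp (-(C * (Real.log 2 - ξ))) * Real.exp (-(C * (ξ - Real.log 2))) = 1 := by
            rw [← Real.exp_add, Real.exp_eq_one_iff]; ring
          calc _ = (Real.exp (-(C * (Real.log 2 - ξ))) * Real.exp (-(C * (ξ - Real.log 2))))
                * ((ξ / Real.log 2) * (Real.log 2 / ξ)) ^ 2 := by ring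
            _ = 1 := by rw [e2]; field_simp
        have := mul_le_mul_of_nonneg_right h1 (distortion_pos (C := C) h0).le
        rwa [mul_assoc, e1, mul_one] at this
      rw [abs_of_nonpos (by linarith)]
      have h5 := mul_le_mul_of_nonneg_left (le_abs_self (distortion C v - 1)) hk.le
      linarith
  have e' : tangentGap a v + curvature a (Real.log 2) * ((v - Real.log 2) ^ 2 / 2)
    = (curvature a (Real.log 2) - curvature a ξ) * ((v - Real.log 2) ^ 2 / 2) := by rw [e]; ring
  rw [e', abs_mul, abs_of_nonneg (by positivity : 0 ≤ (v - Real.log 2) ^ 2 / 2), ← mul_assoc]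
  gcongr

/-- Serves the far range v ≥ 2 log 2, where the distortion factor is too small to be useful and the
gap is compared with its value at 2 log 2. -/
theorem tangentGap_antitone {a : ℝ} (ha : 0 < a) :
    AntitoneOn (tangentGap a) (Ici (Real.log 2)) := by
  have hd : ∀ v, 0 < v → HasDerivAt (tangentGap a)
      (logTermDeriv a v - logTermDeriv a (Real.log 2)) v := fun v hv => by
    have := ((hasDerivAt_logTerm ha hv).sub_const (logTerm a (Real.log 2))).sub
      (((hasDerivAt_id v).sub_const (Real.log 2)).mul_const (logTermDeriv a (Real.log 2)))
    rw [one_mul] at this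
    exact this
  refine antitoneOn_of_deriv_nonpos (convex_Ici _) (fun v hv =>
    (hd v (log_two_pos.trans_le hv)).continuousAt.continuousWithinAt) ?_ ?_
  · rw [interior_Ici]
    exact fun v hv => (hd v (log_two_pos.trans hv)).differentiableAt.differentiableWithinAt
  · rw [interior_Ici]
    intro v hv
    rw [(hd v (log_two_pos.trans hv)).deriv, sub_nonpos]
    have := exp_sub_one_pos ha log_two_pos
    have hv' : Real.log 2 ≤ v := le_of_lt hv
    unfold logTermDeriv
    gcongr

/-- Gaussian domination of the tangent gap on `(0, 1)`, in the variable `τ = e^{-v}`. -/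
theorem tangentGap_neg_log_le {a C τ : ℝ} (ha : 0 < a) (haC : a ≤ C) (h0 : 0 < τ) (h1 : τ < 1) :
    tangentGap a (-Real.log τ)
      ≤ -(curvature a (Real.log 2) * (Real.exp (-(C * Real.log 2)) / 8 * (τ - 1 / 2) ^ 2)) := by
  have hk := curvature_pos ha log_two_pos
  have hC := ha.trans_le haC
  have hl := log_two_pos
  have hE : Real.exp (-(C * Real.log 2)) ≤ 1 := Real.exp_le_one_iff.2 (by nlinarith [mul_pos hC hl])
  have hE0 := Real.exp_pos (-(C * Real.log 2))
  have hv : 0 < -Real.log τ := neg_pos.2 (Real.log_neg h0 h1)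
  have hlog : Real.log (2 * τ) = Real.log 2 + Real.log τ := Real.log_mul two_ne_zero h0.ne'
  -- The worst distortion on [log 2, 2 log 2]; with the 1/2 of Taylor's formula it gives the
  -- constant e^{-C log 2} / 8.
  have hD : Real.exp (-(C * Real.log 2)) / 4 = distortion C (2 * Real.log 2) := by
    unfold distortion
    have : Real.log 2 / (2 * Real.log 2) = 1 / 2 := by field_simp
    rw [this]
    ring_nf
  rcases le_total (-Real.log τ) (Real.log 2) with h | h
  · refine (tangentGap_le_of_le ha hv h).trans ?_
    have hτ : 1 / 2 ≤ τ := by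
      have : Real.log 1 ≤ Real.log (2 * τ) := by rw [Real.log_one, hlog]; linarith
      have := (Real.log_le_log_iff one_pos (by positivity)).1 this
      linarith
    have hb : τ - 1 / 2 ≤ Real.log 2 + Real.log τ := by
      rw [← hlog]
      have h2 := Real.one_sub_inv_le_log_of_pos (show 0 < 2 * τ by positivity)
      have h3 : τ - 1 / 2 ≤ 1 - (2 * τ)⁻¹ := by
        rw [← sub_nonneg]
        have : 1 - (2 * τ)⁻¹ - (τ - 1 / 2) = (2 * τ - 1) * (1 - τ) / (2 * τ) := by
          field_simp
        rw [this]
        have : 0 ≤ 2 * τ - 1 := by linarith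
        have : 0 ≤ 1 - τ := by linarith
        positivity
      linarith
    have hsq : (τ - 1 / 2) ^ 2 ≤ (-Real.log τ - Real.log 2) ^ 2 := by
      rw [← neg_sq (-Real.log τ - Real.log 2)]
      have : 0 ≤ τ - 1 / 2 := by linarith
      apply pow_le_pow_left₀ this; linarith
    gcongr
    nlinarith [sq_nonneg (τ - 1 / 2)]
  · have hτ : τ ≤ 1 / 2 := by
      have : Real.log (2 * τ) ≤ Real.log 1 := by rw [Real.log_one, hlog]; linarith
      have := (Real.log_le_log_iff (by positivity) one_pos).1 this
      linarith
    rcases le_total (-Real.log τ) (2 * Real.log 2) with h' | h'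
    · refine (tangentGap_le_of_ge ha haC h).trans ?_
      have hd := distortion_antitone hC.le hv h'
      rw [← hD] at hd
      have hb : 1 / 2 - τ ≤ -Real.log τ - Real.log 2 := by
        have := Real.log_le_sub_one_of_pos (show 0 < 2 * τ by positivity)
        rw [hlog] at this
        linarith
      have hsq : (τ - 1 / 2) ^ 2 ≤ (-Real.log τ - Real.log 2) ^ 2 := by
        rw [← neg_sq (τ - 1 / 2)]
        have : 0 ≤ 1 / 2 - τ := by linarith
        apply pow_le_pow_left₀ (by linarith); linarith
      have hd0 := distortion_pos (C := C) hv
      rw [mul_assoc]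
      refine neg_le_neg (mul_le_mul_of_nonneg_left ?_ hk.le)
      calc Real.exp (-(C * Real.log 2)) / 8 * (τ - 1 / 2) ^ 2
          = Real.exp (-(C * Real.log 2)) / 4 * ((τ - 1 / 2) ^ 2 / 2) := by ring
        _ ≤ _ := by gcongr
    -- As τ → 0, v is unbounded but (τ - 1/2)² is not, so the bound at v = 2 log 2 suffices.
    · refine (tangentGap_antitone ha (show Real.log 2 ≤ 2 * Real.log 2 by linarith) h h').trans ?_
      refine (tangentGap_le_of_ge ha haC (by linarith)).trans ?_
      rw [← hD, mul_assoc]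
      refine neg_le_neg (mul_le_mul_of_nonneg_left ?_ hk.le)
      have hsq : (τ - 1 / 2) ^ 2 ≤ (Real.log 2) ^ 2 := by
        have := Real.log_two_gt_d9
        nlinarith
      calc Real.exp (-(C * Real.log 2)) / 8 * (τ - 1 / 2) ^ 2
          = Real.exp (-(C * Real.log 2)) / 4 * ((τ - 1 / 2) ^ 2 / 2) := by ring
        _ ≤ Real.exp (-(C * Real.log 2)) / 4 * ((Real.log 2) ^ 2 / 2) := by gcongr
        _ = _ := by ring

end BiasedSampling

/-! ### Deterministic analysis of Φ_m: derivatives, scaling root, maximiser. -/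

namespace BiasedSampling

section Deterministic

variable {w : ℕ → ℝ} {x : ℕ → ℕ} {m : ℕ} {h τ : ℝ}

theorem rpow_eq_exp_neg_mul (hτ : 0 < τ) (a : ℝ) : τ ^ a = Real.exp (-(a * -Real.log τ)) := by
  rw [Real.rpow_def_of_pos hτ]; ring_nf

theorem neg_log_pos (h0 : 0 < τ) (h1 : τ < 1) : 0 < -Real.log τ :=
  neg_pos.2 (Real.log_neg h0 h1)

theorem neg_log_half : -Real.log (1 / 2) = Real.log 2 := by
  rw [one_div, Real.log_inv, neg_neg]

theorem one_sub_rpow_pos (hw : ∀ i, 0 < w i) (hh : 0 < h) (h0 : 0 < τ) (h1 : τ < 1) (i : ℕ) :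
    0 < 1 - τ ^ (h * w i) :=
  sub_pos.2 (Real.rpow_lt_one h0.le h1 (mul_pos hh (hw i)))

theorem PhiWith_pos (hw : ∀ i, 0 < w i) (hδ : 0 < delta w x m) (hh : 0 < h)
    (h0 : 0 < τ) (h1 : τ < 1) : 0 < PhiWith w x m h τ := by
  have h2 : 0 < ∏ i ∈ Finset.range m, (1 - τ ^ (h * w i)) ^ x i :=
    Finset.prod_pos fun i _ => pow_pos (one_sub_rpow_pos hw hh h0 h1 i) _
  have := Real.rpow_pos_of_pos h0 (h * delta w x m - 1)
  unfold PhiWith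
  positivity

theorem log_PhiWith (hw : ∀ i, 0 < w i) (hδ : 0 < delta w x m) (hh : 0 < h)
    (h0 : 0 < τ) (h1 : τ < 1) :
    Real.log (PhiWith w x m h τ) = Real.log (h * delta w x m)
      + (h * delta w x m - 1) * Real.log τ
      + ∑ i ∈ Finset.range m, (x i : ℝ) * logTerm (h * w i) (-Real.log τ) := by
  have hp : ∀ i ∈ Finset.range m, (1 - τ ^ (h * w i)) ^ x i ≠ 0 := fun i _ =>
    (pow_pos (one_sub_rpow_pos hw hh h0 h1 i) _).ne'
  have h2 := (Real.rpow_pos_of_pos h0 (h * delta w x m - 1)).ne'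
  unfold PhiWith
  rw [Real.log_mul (mul_ne_zero (mul_pos hh hδ).ne' h2) (Finset.prod_ne_zero_iff.2 hp),
    Real.log_mul (mul_pos hh hδ).ne' h2, Real.log_rpow h0, Real.log_prod hp]
  congr 1
  refine Finset.sum_congr rfl fun i _ => ?_
  rw [Real.log_pow, logTerm, rpow_eq_exp_neg_mul h0]

/-- `τ` times the logarithmic derivative of `Φ_m(τ; h)`. -/
noncomputable def scaledSlope (w : ℕ → ℝ) (x : ℕ → ℕ) (m : ℕ) (h τ : ℝ) : ℝ :=
  h * delta w x m - 1
    - ∑ i ∈ Finset.range m, (x i : ℝ) * logTermDeriv (h * w i) (-Real.log τ)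

/-- The curvature of `v ↦ -log Φ_m(e^{-v}; h)` at `v = log 2`. -/
noncomputable def totalCurvature (w : ℕ → ℝ) (x : ℕ → ℕ) (m : ℕ) (h : ℝ) : ℝ :=
  ∑ i ∈ Finset.range m, (x i : ℝ) * curvature (h * w i) (Real.log 2)

theorem hasDerivAt_log_PhiWith (hw : ∀ i, 0 < w i) (hδ : 0 < delta w x m) (hh : 0 < h)
    (h0 : 0 < τ) (h1 : τ < 1) :
    HasDerivAt (fun τ => Real.log (PhiWith w x m h τ)) (scaledSlope w x m h τ / τ) τ := by
  have hlog := Real.hasDerivAt_log h0.ne'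
  have hsum : HasDerivAt
      (fun τ => ∑ i ∈ Finset.range m, (x i : ℝ) * logTerm (h * w i) (-Real.log τ))
      (∑ i ∈ Finset.range m, (x i : ℝ) * (logTermDeriv (h * w i) (-Real.log τ) * -τ⁻¹)) τ :=
    HasDerivAt.fun_sum fun i _ =>
      ((hasDerivAt_logTerm (mul_pos hh (hw i)) (neg_log_pos h0 h1)).comp τ hlog.fun_neg).const_mul _
  have hd := ((hlog.const_mul (h * delta w x m - 1)).const_add
    (Real.log (h * delta w x m))).fun_add hsum
  refine (hd.congr_of_eventuallyEq ?_).congr_deriv ?_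
  · filter_upwards [Ioo_mem_nhds h0 h1] with y hy
    exact log_PhiWith hw hδ hh hy.1 hy.2
  · simp only [← mul_assoc, ← Finset.sum_mul]
    unfold scaledSlope
    field_simp
    ring

theorem hasDerivAt_scaledSlope_half (hw : ∀ i, 0 < w i) (hh : 0 < h) :
    HasDerivAt (scaledSlope w x m h) (-(2 * totalCurvature w x m h)) (1 / 2) := by
  have hlog := Real.hasDerivAt_log (show (1 / 2 : ℝ) ≠ 0 by norm_num)
  have hd := (HasDerivAt.fun_sum (u := Finset.range m) fun i _ =>
      ((hasDerivAt_logTermDeriv (mul_pos hh (hw i))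
        (neg_log_pos (τ := 1 / 2) (by norm_num) (by norm_num))).comp (1 / 2)
          hlog.fun_neg).const_mul (x i : ℝ)).const_sub (h * delta w x m - 1)
  refine hd.congr_deriv ?_
  rw [neg_log_half, totalCurvature, Finset.mul_sum, ← Finset.sum_neg_distrib,
    ← Finset.sum_neg_distrib]
  refine Finset.sum_congr rfl fun i _ => ?_
  ring

theorem scaledSlope_half (hh : 0 < h) : scaledSlope w x m h (1 / 2) = h * zFun w x m h := by
  unfold scaledSlope zFun
  rw [neg_log_half, mul_sub, mul_sub, Finset.mul_sum, mul_one_div_cancel hh.ne']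
  congr 1
  refine Finset.sum_congr rfl fun i _ => ?_
  unfold logTermDeriv
  rw [Real.rpow_def_of_pos two_pos, mul_comm (Real.log 2)]
  ring

theorem zFun_eq_deriv (hw : ∀ i, 0 < w i) (hδ : 0 < delta w x m) (hh : 0 < h) :
    zFun w x m h = deriv (fun τ => Real.log (PhiWith w x m h τ)) (1 / 2) / (2 * h) := by
  rw [(hasDerivAt_log_PhiWith hw hδ hh (by norm_num) (by norm_num)).deriv, scaledSlope_half hh]
  field_simp

/-- The logarithmic derivative is `scaledSlope` divided by τ. At a root the slope vanishes at 1/2,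
so only its own derivative survives, divided by 1/2. -/
theorem iteratedDeriv_two_log_PhiWith (hw : ∀ i, 0 < w i) (hδ : 0 < delta w x m) (hh : 0 < h)
    (hz : zFun w x m h = 0) :
    iteratedDeriv 2 (fun τ => Real.log (PhiWith w x m h τ)) (1 / 2)
      = -(4 * totalCurvature w x m h) := by
  rw [iteratedDeriv_succ, iteratedDeriv_one]
  have he : deriv (fun τ => Real.log (PhiWith w x m h τ)) =ᶠ[𝓝 (1 / 2)]
      fun τ => scaledSlope w x m h τ / τ := by
    filter_upwards [Ioo_mem_nhds (show (0 : ℝ) < 1 / 2 by norm_num)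
      (show (1 / 2 : ℝ) < 1 by norm_num)] with y hy
    exact (hasDerivAt_log_PhiWith hw hδ hh hy.1 hy.2).deriv
  rw [he.deriv_eq, ((hasDerivAt_scaledSlope_half hw hh).fun_div (hasDerivAt_id' _)
    (by norm_num)).deriv, scaledSlope_half hh, hz]
  ring

theorem two_rpow_sub_one_ge (a : ℝ) : a * Real.log 2 ≤ (2 : ℝ) ^ a - 1 := by
  rw [Real.rpow_def_of_pos two_pos]
  linarith [Real.add_one_le_exp (Real.log 2 * a)]

theorem two_rpow_sub_one_pos (hw : ∀ i, 0 < w i) (hh : 0 < h) (i : ℕ) :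
    0 < (2 : ℝ) ^ (h * w i) - 1 :=
  (mul_pos (mul_pos hh (hw i)) log_two_pos).trans_le (two_rpow_sub_one_ge _)

theorem zFun_strictMonoOn (hw : ∀ i, 0 < w i) : StrictMonoOn (zFun w x m) (Ioi 0) := by
  intro a ha b hb hab
  have ha' : 0 < a := ha
  have h1 : ∑ i ∈ Finset.range m, (x i : ℝ) * w i / ((2 : ℝ) ^ (b * w i) - 1)
      ≤ ∑ i ∈ Finset.range m, (x i : ℝ) * w i / ((2 : ℝ) ^ (a * w i) - 1) := by
    refine Finset.sum_le_sum fun i _ => ?_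
    have h2 := two_rpow_sub_one_pos hw ha' i
    have h3 := (hw i).le
    have h4 : (2 : ℝ) ^ (a * w i) ≤ (2 : ℝ) ^ (b * w i) :=
      Real.rpow_le_rpow_of_exponent_le one_le_two (by gcongr)
    gcongr
  have h5 : 1 / b < 1 / a := one_div_lt_one_div_of_lt ha' hab
  unfold zFun
  linarith

theorem zFun_continuousOn (hw : ∀ i, 0 < w i) : ContinuousOn (zFun w x m) (Ioi 0) := by
  intro a ha
  have ha' : a ≠ 0 := (mem_Ioi.1 ha).ne'
  refine ContinuousAt.continuousWithinAt ?_
  unfold zFun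
  refine (continuousAt_const.sub (continuousAt_const.div continuousAt_id ha')).sub ?_
  refine tendsto_finsetSum _ fun i _ => ?_
  refine ContinuousAt.div continuousAt_const ?_ (two_rpow_sub_one_pos hw ha i).ne'
  exact (continuousAt_const.rpow (by fun_prop) (Or.inl two_ne_zero)).sub continuousAt_const

/-- An explicit upper bound for the scaling parameter. -/
theorem exists_root_le (hw : ∀ i, 0 < w i) (hδ : 0 < delta w x m) :
    ∃ h, IsScalingRoot w x m h ∧ h ≤ (1 + successes x m / Real.log 2) / delta w x m := by
  -- Since 2^a - 1 ≥ a log 2, each success contributes at most 1 / (H log 2) to the sum in z(H).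
  -- This H makes the resulting lower bound for z(H) exactly zero; at 1 / δ_m the first two terms of
  -- z cancel.
  set H := (1 + successes x m / Real.log 2) / delta w x m with hH
  have hl := log_two_pos
  have hle : 1 / delta w x m ≤ H := by
    rw [hH]; gcongr
    have : (0 : ℝ) ≤ successes x m / Real.log 2 := by positivity
    linarith
  have hδ' : 0 < 1 / delta w x m := by positivity
  have hH0 : 0 < H := hδ'.trans_le hle
  have hlow : zFun w x m (1 / delta w x m) ≤ 0 := by
    have : 0 ≤ ∑ i ∈ Finset.range m,
        (x i : ℝ) * w i / ((2 : ℝ) ^ (1 / delta w x m * w i) - 1) :=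
      Finset.sum_nonneg fun i _ =>
        div_nonneg (mul_nonneg (Nat.cast_nonneg _) (hw i).le) (two_rpow_sub_one_pos hw hδ' i).le
    unfold zFun
    rw [one_div_one_div]
    linarith
  have hup : 0 ≤ zFun w x m H := by
    have hs : ∑ i ∈ Finset.range m, (x i : ℝ) * w i / ((2 : ℝ) ^ (H * w i) - 1)
        ≤ ∑ i ∈ Finset.range m, (x i : ℝ) * (1 / (H * Real.log 2)) := by
      refine Finset.sum_le_sum fun i _ => ?_
      rw [mul_div_assoc]
      refine mul_le_mul_of_nonneg_left ?_ (Nat.cast_nonneg _)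
      rw [div_le_div_iff₀ (two_rpow_sub_one_pos hw hH0 i) (by positivity)]
      linarith [two_rpow_sub_one_ge (H * w i)]
    rw [← Finset.sum_mul] at hs
    have hc : (∑ i ∈ Finset.range m, (x i : ℝ)) = successes x m := by
      unfold successes; push_cast; rfl
    rw [hc] at hs
    have he : delta w x m - 1 / H - successes x m * (1 / (H * Real.log 2)) = 0 := by
      have h1 : H * delta w x m = 1 + successes x m / Real.log 2 := by
        rw [hH]; field_simp
      have h2 : delta w x m - 1 / H - successes x m * (1 / (H * Real.log 2))
        = (H * delta w x m - (1 + successes x m / Real.log 2)) / H := by field_simp; ring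
      rw [h2, h1]; simp
    unfold zFun
    linarith
  have hsub : Icc (1 / delta w x m) H ⊆ Ioi 0 := fun y hy => hδ'.trans_le hy.1
  obtain ⟨h, hh, hz⟩ := intermediate_value_Icc hle ((zFun_continuousOn hw).mono hsub) ⟨hlow, hup⟩
  exact ⟨h, ⟨hh.1, hz⟩, hh.2⟩

theorem IsScalingRoot.pos (hδ : 0 < delta w x m) (hr : IsScalingRoot w x m h) : 0 < h :=
  (one_div_pos.2 hδ).trans_le hr.1

theorem IsScalingRoot.unique (hw : ∀ i, 0 < w i) (hδ : 0 < delta w x m) {h' : ℝ}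
    (hr : IsScalingRoot w x m h) (hr' : IsScalingRoot w x m h') : h = h' :=
  (zFun_strictMonoOn hw).injOn (hr.pos hδ) (hr'.pos hδ) (hr.2.trans hr'.2.symm)

theorem existsUnique_root (hw : ∀ i, 0 < w i) (hδ : 0 < delta w x m) :
    ∃! h, IsScalingRoot w x m h := by
  obtain ⟨h, hr, -⟩ := exists_root_le hw hδ
  exact ⟨h, hr, fun h' hr' => hr'.unique hw hδ hr⟩

theorem isScalingRoot_scaling (hw : ∀ i, 0 < w i) (hδ : 0 < delta w x m) :
    IsScalingRoot w x m (scaling w x m) :=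
  Classical.epsilon_spec (existsUnique_root hw hδ).exists

theorem scaling_le (hw : ∀ i, 0 < w i) (hδ : 0 < delta w x m) :
    scaling w x m ≤ (1 + successes x m / Real.log 2) / delta w x m := by
  obtain ⟨h, hr, hle⟩ := exists_root_le hw hδ
  rwa [(isScalingRoot_scaling hw hδ).unique hw hδ hr]

/-- The root equation reads h δ_m - 1 = ∑ x_i · `logTermDeriv (h * w i) (log 2)`, so the power of τ
supplies exactly the tangent terms. -/
theorem PhiWith_eq_mul_exp (hw : ∀ i, 0 < w i) (hδ : 0 < delta w x m) (hh : 0 < h)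
    (hz : zFun w x m h = 0) (h0 : 0 < τ) (h1 : τ < 1) :
    PhiWith w x m h τ = PhiWith w x m h (1 / 2)
      * Real.exp (∑ i ∈ Finset.range m, (x i : ℝ) * tangentGap (h * w i) (-Real.log τ)) := by
  have hp := PhiWith_pos hw hδ hh h0 h1
  have hp' := PhiWith_pos hw hδ hh (τ := 1 / 2) (by norm_num) (by norm_num)
  have hs := scaledSlope_half (w := w) (x := x) (m := m) hh
  rw [hz, mul_zero, scaledSlope, neg_log_half, sub_eq_zero] at hs
  rw [← Real.exp_log hp, ← Real.exp_log hp', ← Real.exp_add]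
  congr 1
  rw [log_PhiWith hw hδ hh h0 h1,
    log_PhiWith hw hδ hh (by norm_num) (by norm_num), hs, neg_log_half,
    ← neg_neg (Real.log (1 / 2)), neg_log_half]
  have : ∑ i ∈ Finset.range m, (x i : ℝ) * tangentGap (h * w i) (-Real.log τ)
      = ∑ i ∈ Finset.range m, (x i : ℝ) * logTerm (h * w i) (-Real.log τ)
        - ∑ i ∈ Finset.range m, (x i : ℝ) * logTerm (h * w i) (Real.log 2)
        + (∑ i ∈ Finset.range m, (x i : ℝ) * logTermDeriv (h * w i) (Real.log 2))
          * (Real.log τ + Real.log 2) := by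
    rw [Finset.sum_mul, ← Finset.sum_sub_distrib, ← Finset.sum_add_distrib]
    refine Finset.sum_congr rfl fun i _ => ?_
    unfold tangentGap
    ring
  rw [this]
  ring

theorem sum_tangentGap_le {C : ℝ} (hw : ∀ i, w i ∈ Ioo (0 : ℝ) 1) (hh : 0 < h) (hC : h ≤ C)
    (h0 : 0 < τ) (h1 : τ < 1) :
    ∑ i ∈ Finset.range m, (x i : ℝ) * tangentGap (h * w i) (-Real.log τ)
      ≤ -(totalCurvature w x m h * (Real.exp (-(C * Real.log 2)) / 8 * (τ - 1 / 2) ^ 2)) := by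
  rw [totalCurvature, Finset.sum_mul, ← Finset.sum_neg_distrib]
  refine Finset.sum_le_sum fun i _ => ?_
  have haC : h * w i ≤ C := by nlinarith [(hw i).2]
  have := mul_le_mul_of_nonneg_left
    (tangentGap_neg_log_le (mul_pos hh (hw i).1) haC h0 h1) (Nat.cast_nonneg (α := ℝ) (x i))
  linarith

theorem abs_sum_tangentGap_add_le {C v : ℝ} (hw : ∀ i, w i ∈ Ioo (0 : ℝ) 1) (hh : 0 < h)
    (hC : h ≤ C) (hv : 0 < v) :
    |∑ i ∈ Finset.range m, (x i : ℝ) * tangentGap (h * w i) v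
        + totalCurvature w x m h * ((v - Real.log 2) ^ 2 / 2)|
      ≤ totalCurvature w x m h * (|distortion C v - 1| * ((v - Real.log 2) ^ 2 / 2)) := by
  rw [totalCurvature, Finset.sum_mul, Finset.sum_mul, ← Finset.sum_add_distrib]
  refine (Finset.abs_sum_le_sum_abs _ _).trans (Finset.sum_le_sum fun i _ => ?_)
  have haC : h * w i ≤ C := by nlinarith [(hw i).2]
  rw [mul_assoc, ← mul_add, abs_mul, Nat.abs_cast, mul_assoc]
  gcongr
  exact abs_tangentGap_add_le (mul_pos hh (hw i).1) haC hv

theorem le_totalCurvature {C : ℝ} (hw : ∀ i, w i ∈ Ioo (0 : ℝ) 1) (hh : 0 < h) (hC : h ≤ C) :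
    successes x m * (Real.exp (-(C * Real.log 2)) / (Real.log 2) ^ 2)
      ≤ totalCurvature w x m h := by
  unfold successes totalCurvature
  push_cast
  rw [Finset.sum_mul]
  refine Finset.sum_le_sum fun i _ => ?_
  have haC : h * w i ≤ C := by nlinarith [(hw i).2]
  gcongr
  exact le_curvature (mul_pos hh (hw i).1) haC log_two_pos

theorem totalCurvature_pos (hw : ∀ i, w i ∈ Ioo (0 : ℝ) 1) (hh : 0 < h)
    (hs : 0 < successes x m) : 0 < totalCurvature w x m h := by
  refine lt_of_lt_of_le ?_ (le_totalCurvature hw hh le_rfl)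
  have := log_two_pos
  positivity

theorem argmax_Phi (hw : ∀ i, w i ∈ Ioo (0 : ℝ) 1) (hδ : 0 < delta w x m)
    (hs : 0 < successes x m) :
    {τ ∈ Icc (0 : ℝ) 1 | IsMaxOn (Phi w x m) (Icc 0 1) τ} = {1 / 2} := by
  have hw' : ∀ i, 0 < w i := fun i => (hw i).1
  have hr := isScalingRoot_scaling hw' hδ
  have hh := hr.pos hδ
  have hp := PhiWith_pos hw' hδ hh (τ := 1 / 2) (by norm_num) (by norm_num)
  obtain ⟨j, hj, hxj⟩ : ∃ j ∈ Finset.range m, x j ≠ 0 := by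
    by_contra! hc
    exact hs.ne' (Finset.sum_eq_zero hc)
  have key : ∀ τ ∈ Icc (0 : ℝ) 1, τ ≠ 1 / 2 → Phi w x m τ < Phi w x m (1 / 2) := by
    intro τ hτ hne
    rcases hτ.1.eq_or_lt with rfl | h0
    -- The root equation makes the exponent h_m δ_m - 1 a positive sum, so the power vanishes at 0;
    -- a zero exponent would give 0 ^ 0 = 1.
    · have hs' := scaledSlope_half (w := w) (x := x) (m := m) hh
      rw [hr.2, mul_zero, scaledSlope, neg_log_half, sub_eq_zero] at hs'
      have hpos : 0 < ∑ i ∈ Finset.range m,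
          (x i : ℝ) * logTermDeriv (scaling w x m * w i) (Real.log 2) := by
        have hd : ∀ i, 0 < logTermDeriv (scaling w x m * w i) (Real.log 2) := fun i =>
          div_pos (mul_pos hh (hw' i)) (exp_sub_one_pos (mul_pos hh (hw' i)) log_two_pos)
        refine Finset.sum_pos' (fun i _ => mul_nonneg (Nat.cast_nonneg _) (hd i).le)
          ⟨j, hj, mul_pos (Nat.cast_pos.2 (Nat.pos_of_ne_zero hxj)) (hd j)⟩
      have : Phi w x m 0 = 0 := by
        unfold Phi PhiWith
        rw [Real.zero_rpow (by linarith)]; ring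
      rw [this]
      exact hp
    · rcases hτ.2.eq_or_lt with rfl | h1
      -- At τ = 1 the factor of any success is zero.
      · have : Phi w x m 1 = 0 := by
          unfold Phi PhiWith
          rw [Finset.prod_eq_zero hj (by simp [hxj]), mul_zero]
        rw [this]
        exact hp
      · have hlt : ∑ i ∈ Finset.range m,
            (x i : ℝ) * tangentGap (scaling w x m * w i) (-Real.log τ) < 0 := by
          refine (sum_tangentGap_le hw hh le_rfl h0 h1).trans_lt ?_
          have h2 := totalCurvature_pos (x := x) hw hh hs
          have h3 : 0 < (τ - 1 / 2) ^ 2 := by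
            have := sub_ne_zero.2 hne
            positivity
          have h4 := Real.exp_pos (-(scaling w x m * Real.log 2))
          rw [neg_lt_zero]
          positivity
        unfold Phi at hp ⊢
        rw [PhiWith_eq_mul_exp hw' hδ hh hr.2 h0 h1]
        exact mul_lt_of_lt_one_right hp (Real.exp_lt_one_iff.2 hlt)
  ext τ
  simp only [mem_ofPred_eq, mem_singleton_iff]
  constructor
  · rintro ⟨hτ, hmax⟩
    by_contra hne
    exact (key τ hτ hne).not_ge (hmax (show (1 / 2 : ℝ) ∈ Icc (0 : ℝ) 1 by norm_num))
  · rintro rfl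
    refine ⟨by norm_num, fun τ hτ => ?_⟩
    change Phi w x m τ ≤ Phi w x m (1 / 2)
    rcases eq_or_ne τ (1 / 2) with rfl | hne
    · exact le_rfl
    · exact (key τ hτ hne).le

end Deterministic

end BiasedSampling

/-! ### Laplace's method in abstract form. -/

namespace BiasedSampling

/-- Laplace's method by dominated convergence after rescaling around `1/2`. -/
theorem tendsto_sqrt_mul_integral {V : ℕ → ℝ} (hV : Tendsto V atTop atTop) {g : ℕ → ℝ → ℝ}
    (hg : ∀ᶠ m in atTop, ContinuousOn (g m) (Ioo 0 1)) {K c : ℝ} (hK : 0 ≤ K) (hc : 0 < c)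
    (hbound : ∀ᶠ m in atTop, ∀ τ ∈ Ioo (0 : ℝ) 1,
      |g m τ| ≤ K * Real.exp (-(c * V m * (τ - 1 / 2) ^ 2)))
    (hlim : ∀ t : ℝ, Tendsto (fun m => g m (1 / 2 + t / √(V m))) atTop
      (𝓝 (Real.exp (-(1 / 2) * t ^ 2)))) :
    Tendsto (fun m => √(V m) * ∫ τ in (0 : ℝ)..1, g m τ) atTop (𝓝 √(2 * Real.pi)) := by
  -- Extension by zero lets the substitution τ = 1/2 + t / √V be made on the whole line, with a
  -- fixed domain for dominated convergence.
  set G : ℕ → ℝ → ℝ := fun m => (Ioo (0 : ℝ) 1).indicator (g m) with hG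
  have hVpos : ∀ᶠ m in atTop, 0 < V m := hV.eventually_gt_atTop 0
  have heq : ∀ᶠ m in atTop, ∫ t, G m (1 / 2 + t / √(V m)) = √(V m) * ∫ τ in (0 : ℝ)..1, g m τ := by
    filter_upwards [hVpos] with m hm
    rw [Measure.integral_comp_div (fun t => G m (1 / 2 + t)), integral_add_left_eq_self,
      intervalIntegral.integral_of_le zero_le_one, integral_Ioc_eq_integral_Ioo,
      hG, integral_indicator measurableSet_Ioo, abs_of_nonneg (Real.sqrt_nonneg _), smul_eq_mul]
  refine Tendsto.congr' heq ?_
  have hgauss : ∫ t : ℝ, Real.exp (-(1 / 2) * t ^ 2) = √(2 * Real.pi) := by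
    rw [integral_gaussian]
    congr 1
    ring
  rw [← hgauss]
  refine tendsto_integral_filter_of_dominated_convergence
    (fun t => K * Real.exp (-c * t ^ 2)) ?_ ?_ ((integrable_exp_neg_mul_sq hc).const_mul K) ?_
  · filter_upwards [hg] with m hm
    have h1 : Measurable (G m) := by
      classical
      have := hm.measurable_piecewise (g := 0) continuousOn_const measurableSet_Ioo
      rwa [piecewise_eq_indicator] at this
    exact (h1.comp (by fun_prop : Measurable fun t : ℝ => 1 / 2 + t / √(V m))).aestronglyMeasurable
  · filter_upwards [hbound, hVpos] with m hm hpos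
    refine Eventually.of_forall fun t => ?_
    rw [Real.norm_eq_abs, hG]
    by_cases ht : 1 / 2 + t / √(V m) ∈ Ioo (0 : ℝ) 1
    · simp only [indicator_of_mem ht]
      refine (hm _ ht).trans_eq ?_
      have h1 : (1 / 2 + t / √(V m) - 1 / 2) ^ 2 = t ^ 2 / V m := by
        rw [add_sub_cancel_left, div_pow, Real.sq_sqrt hpos.le]
      rw [h1]
      congr 2
      field_simp
    · simp only [indicator_of_notMem ht, abs_zero]
      positivity
  · refine Eventually.of_forall fun t => ?_
    have h1 : Tendsto (fun m => 1 / 2 + t / √(V m)) atTop (𝓝 (1 / 2 + 0)) :=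
      tendsto_const_nhds.add ((Real.tendsto_sqrt_atTop.comp hV).const_div_atTop t)
    rw [add_zero] at h1
    refine (hlim t).congr' ?_
    filter_upwards [h1.eventually (Ioo_mem_nhds (show (0 : ℝ) < 1 / 2 by norm_num)
      (show (1 / 2 : ℝ) < 1 by norm_num))] with m hm
    exact (indicator_of_mem (show 1 / 2 + t / √(V m) ∈ Ioo (0 : ℝ) 1 from hm) _).symm

end BiasedSampling

/-! ### Strong law for the Bernoulli model. -/

namespace BiasedSampling

/-- The Bernoulli weight of the outcome `b` with success probability `y`. -/
noncomputable def bernoulliWeight (b : ℕ) (y : ℝ) : ℝ := if b = 1 then y else 1 - y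

theorem measurable_bernoulliWeight (b : ℕ) : Measurable (bernoulliWeight b) := by
  unfold bernoulliWeight
  split_ifs <;> fun_prop

variable {Ω : Type*} [MeasurableSpace Ω] {P : Measure Ω}

theorem indepFun_indicator_of_indepSet {A B : Set Ω} (h : IndepSet A B P) :
    IndepFun (A.indicator fun _ => (1 : ℝ)) (B.indicator fun _ => (1 : ℝ)) P := by
  have hm : ∀ A : Set Ω, MeasurableSpace.comap (A.indicator fun _ => (1 : ℝ)) inferInstance
      ≤ MeasurableSpace.generateFrom {A} := fun A =>
    Measurable.comap_le (Measurable.indicator (m := MeasurableSpace.generateFrom {A})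
      measurable_const (MeasurableSpace.measurableSet_generateFrom (mem_singleton A)))
  exact indep_of_indep_of_le_left (indep_of_indep_of_le_right h (hm B)) (hm A)

theorem identDistrib_indicator [IsProbabilityMeasure P] {A B : Set Ω} (hA : MeasurableSet A)
    (hB : MeasurableSet B) (h : P A = P B) :
    IdentDistrib (A.indicator fun _ => (1 : ℝ)) (B.indicator fun _ => (1 : ℝ)) P P := by
  have hAm : Measurable (A.indicator fun _ => (1 : ℝ)) := measurable_const.indicator hA
  have hBm : Measurable (B.indicator fun _ => (1 : ℝ)) := measurable_const.indicator hB
  refine ⟨hAm.aemeasurable, hBm.aemeasurable, ?_⟩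
  ext U hU
  rw [Measure.map_apply hAm hU, Measure.map_apply hBm hU]
  classical
  rw [indicator_const_preimage_eq_union, indicator_const_preimage_eq_union]
  by_cases h1 : (1 : ℝ) ∈ U <;> by_cases h0 : (0 : ℝ) ∈ U <;>
    simp [h1, h0, h, prob_compl_eq_one_sub hA, prob_compl_eq_one_sub hB]

/-- Strong law of large numbers for pairwise independent events of equal probability. -/
theorem tendsto_frequency [IsProbabilityMeasure P] {A : ℕ → Set Ω}
    (hA : ∀ i, MeasurableSet (A i)) {p : ℝ} (hp : ∀ i, P.real (A i) = p)
    (hpair : ∀ i j, i ≠ j → P.real (A i ∩ A j) = p * p) :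
    ∀ᵐ ω ∂P, Tendsto (fun n : ℕ => (∑ i ∈ Finset.range n, (A i).indicator (fun _ => (1 : ℝ)) ω) / n)
      atTop (𝓝 p) := by
  have hint : Integrable ((A 0).indicator fun _ => (1 : ℝ)) P :=
    (integrable_const _).indicator (hA 0)
  have h := strong_law_ae_real (fun i => (A i).indicator fun _ => (1 : ℝ)) hint
    (fun i j hij => indepFun_indicator_of_indepSet
      ((indepSet_iff_measure_inter_eq_mul (hA i) (hA j) P).2 ?_))
    (fun i => identDistrib_indicator (hA i) (hA 0) ?_)
  · rw [integral_indicator_const _ (hA 0), hp 0, smul_eq_mul, mul_one] at h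
    exact h
  · rw [← ENNReal.toReal_eq_toReal_iff' (measure_ne_top _ _)
      (ENNReal.mul_ne_top (measure_ne_top _ _) (measure_ne_top _ _)), ENNReal.toReal_mul]
    have := hpair i j hij
    rw [measureReal_def] at this
    rw [this, ← hp i, measureReal_def]
    congr 1
    rw [← measureReal_def, ← measureReal_def, hp, hp]
  · rw [← ENNReal.toReal_eq_toReal_iff' (measure_ne_top _ _) (measure_ne_top _ _),
      ← measureReal_def, ← measureReal_def, hp, hp]

variable [IsProbabilityMeasure P] {F : Measure ℝ} {w : ℕ → Ω → ℝ} {x : ℕ → Ω → ℕ}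

/-- Integrates the conditional law of the indicators over an event measurable with respect to the
weights. Singletons and pairs then give equal probabilities and pairwise independence, all that the
strong law requires. -/
theorem IsBernoulliModel.measureReal_eq_integral_prod (hwx : IsBernoulliModel P F w x)
    {S : Set ℝ} (hS : MeasurableSet S) {b : ℕ} (hb : b = 0 ∨ b = 1) (s : Finset ℕ) :
    P.real {ω | ∀ i ∈ s, x i ω = b ∧ w i ω ∈ S}
      = ∫ ω, ∏ i ∈ s, S.indicator (bernoulliWeight b) (w i ω) ∂P := by
  set E : Set Ω := {ω | ∀ i ∈ s, x i ω = b} with hE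
  set T : Set Ω := {ω | ∀ i ∈ s, w i ω ∈ S} with hT
  have hm : (⨆ i, MeasurableSpace.comap (w i) inferInstance) ≤ ‹MeasurableSpace Ω› :=
    iSup_le fun i => (hwx.measurable_w i).comap_le
  have hTm : MeasurableSet[⨆ i, MeasurableSpace.comap (w i) inferInstance] T := by
    have : T = ⋂ i ∈ s, (w i) ⁻¹' S := by ext; simp [hT]
    rw [this]
    refine Finset.measurableSet_biInter _ fun i _ => ?_
    exact le_iSup (fun i => MeasurableSpace.comap (w i) inferInstance) i _ ⟨S, hS, rfl⟩
  have hEm : MeasurableSet E := by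
    have : E = ⋂ i ∈ s, (x i) ⁻¹' {b} := by ext; simp [hE]
    rw [this]
    exact Finset.measurableSet_biInter _ fun i _ => hwx.measurable_x i (measurableSet_singleton b)
  have hset : {ω | ∀ i ∈ s, x i ω = b ∧ w i ω ∈ S} = E ∩ T := by
    ext ω
    simp only [hE, hT, mem_ofPred_eq, mem_inter_iff]
    exact ⟨fun h => ⟨fun i hi => (h i hi).1, fun i hi => (h i hi).2⟩,
      fun h i hi => ⟨h.1 i hi, h.2 i hi⟩⟩
  have h1 := setIntegral_condExp (μ := P) hm
    ((integrable_const (1 : ℝ)).indicator hEm) hTm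
  rw [integral_indicator_const _ hEm, smul_eq_mul, mul_one,
    measureReal_restrict_apply hEm] at h1
  rw [hset, ← h1, setIntegral_congr_ae (hm _ hTm)
    ((hwx.cond_law_x s (fun _ => b) fun _ => hb).mono fun ω hω _ => hω),
    ← integral_indicator (hm _ hTm)]
  refine integral_congr_ae (Eventually.of_forall fun ω => ?_)
  by_cases hω : ω ∈ T
  · simp only [indicator_of_mem hω]
    refine Finset.prod_congr rfl fun i hi => ?_
    rw [indicator_of_mem (hω i hi)]
    rfl
  · simp only [indicator_of_notMem hω]
    obtain ⟨i, hi, hiS⟩ : ∃ i ∈ s, w i ω ∉ S := by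
      by_contra! hc
      exact hω hc
    exact (Finset.prod_eq_zero hi (indicator_of_notMem hiS _)).symm

/-- The frequency of the event that the outcome is `b` and the weight lies in `S`. -/
theorem IsBernoulliModel.tendsto_frequency (hwx : IsBernoulliModel P F w x)
    {S : Set ℝ} (hS : MeasurableSet S) {b : ℕ} (hb : b = 0 ∨ b = 1) :
    ∀ᵐ ω ∂P, Tendsto (fun n : ℕ => (∑ i ∈ Finset.range n,
      {ω | x i ω = b ∧ w i ω ∈ S}.indicator (fun _ => (1 : ℝ)) ω) / n)
      atTop (𝓝 (∫ y, S.indicator (bernoulliWeight b) y ∂F)) := by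
  have hmeas : Measurable (S.indicator (bernoulliWeight b)) :=
    (measurable_bernoulliWeight b).indicator hS
  have hlaw : ∀ i, ∫ ω, S.indicator (bernoulliWeight b) (w i ω) ∂P
      = ∫ y, S.indicator (bernoulliWeight b) y ∂F := fun i => by
    rw [← hwx.law_w i, integral_map (hwx.measurable_w i).aemeasurable hmeas.aestronglyMeasurable]
  refine BiasedSampling.tendsto_frequency (fun i => ?_) (fun i => ?_) (fun i j hij => ?_)
  · exact (hwx.measurable_x i (measurableSet_singleton b)).inter (hwx.measurable_w i hS)
  · have := hwx.measureReal_eq_integral_prod hS hb {i}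
    simpa [hlaw] using this
  · have := hwx.measureReal_eq_integral_prod hS hb {i, j}
    simp only [Finset.prod_pair hij] at this
    rw [(hwx.indep_w.indepFun hij).integral_fun_comp_mul_comp (hwx.measurable_w i).aemeasurable
      (hwx.measurable_w j).aemeasurable hmeas.aestronglyMeasurable hmeas.aestronglyMeasurable,
      hlaw, hlaw] at this
    rw [← this]
    congr 1
    ext ω
    simp

theorem integral_bernoulliWeight_pos [IsProbabilityMeasure F] (hF : F (Ioo (0 : ℝ) 1) = 1)
    {S : Set ℝ} (hS : MeasurableSet S) (hFS : F S ≠ 0) (b : ℕ) :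
    0 < ∫ y, S.indicator (bernoulliWeight b) y ∂F := by
  have hae : ∀ᵐ y ∂F, y ∈ Ioo (0 : ℝ) 1 := (prob_compl_eq_zero_iff measurableSet_Ioo).2 hF
  have hw : ∀ y ∈ Ioo (0 : ℝ) 1, 0 < bernoulliWeight b y ∧ bernoulliWeight b y ≤ 1 := by
    intro y hy
    unfold bernoulliWeight
    split_ifs
    · exact ⟨hy.1, hy.2.le⟩
    · exact ⟨by linarith [hy.2], by linarith [hy.1]⟩
  have hmeas : Measurable (S.indicator (bernoulliWeight b)) :=
    (measurable_bernoulliWeight b).indicator hS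
  have hnn : 0 ≤ᵐ[F] S.indicator (bernoulliWeight b) := by
    filter_upwards [hae] with y hy
    exact indicator_apply_nonneg fun _ => (hw y hy).1.le
  have hint : Integrable (S.indicator (bernoulliWeight b)) F := by
    refine Integrable.of_bound hmeas.aestronglyMeasurable 1 ?_
    filter_upwards [hae] with y hy
    by_cases hyS : y ∈ S
    · rw [indicator_of_mem hyS, Real.norm_of_nonneg (hw y hy).1.le]
      exact (hw y hy).2
    · simp [hyS]
  rw [integral_pos_iff_support_of_nonneg_ae hnn hint]
  refine lt_of_lt_of_le (pos_iff_ne_zero.2 hFS) (measure_mono_ae ?_)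
  filter_upwards [hae] with y hy hyS
  show S.indicator (bernoulliWeight b) y ≠ 0
  rw [indicator_of_mem hyS]
  exact (hw y hy).1.ne'

theorem exists_measure_Ici_ne_zero (hF : F (Ioo (0 : ℝ) 1) = 1) :
    ∃ ε > (0 : ℝ), F (Ici ε) ≠ 0 := by
  by_contra! hc
  have hsub : Ioo (0 : ℝ) 1 ⊆ ⋃ n : ℕ, Ici (1 / ((n : ℝ) + 1)) := fun y hy => by
    obtain ⟨n, hn⟩ := exists_nat_one_div_lt hy.1
    exact mem_iUnion.2 ⟨n, hn.le⟩
  have := measure_mono_null hsub (measure_iUnion_null fun n => hc _ Nat.one_div_pos_of_nat)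
  rw [hF] at this
  exact one_ne_zero this

/-- Almost surely both `s_m` and `δ_m` grow linearly. -/
theorem IsBernoulliModel.ae_linear_growth (hwx : IsBernoulliModel P F w x)
    (hF : F (Ioo (0 : ℝ) 1) = 1) :
    ∃ c > (0 : ℝ), ∀ᵐ ω ∂P, (∀ i, w i ω ∈ Ioo (0 : ℝ) 1) ∧ (∀ i, x i ω ≤ 1) ∧
      ∀ᶠ m : ℕ in atTop, c * m ≤ successes (x · ω) m ∧ c * m ≤ delta (w · ω) (x · ω) m := by
  have hFp : IsProbabilityMeasure F := by
    rw [← hwx.law_w 0]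
    exact Measure.isProbabilityMeasure_map (hwx.measurable_w 0).aemeasurable
  obtain ⟨ε, hε, hFε⟩ := exists_measure_Ici_ne_zero hF
  have hp := integral_bernoulliWeight_pos hF MeasurableSet.univ (by simp : F univ ≠ 0) 1
  have hq := integral_bernoulliWeight_pos hF measurableSet_Ici hFε 0
  set p := ∫ y, univ.indicator (bernoulliWeight 1) y ∂F
  set q := ∫ y, (Ici ε).indicator (bernoulliWeight 0) y ∂F
  have hwae : ∀ᵐ ω ∂P, ∀ i, w i ω ∈ Ioo (0 : ℝ) 1 := ae_all_iff.2 fun i => by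
    have : ∀ᵐ y ∂(P.map (w i)), y ∈ Ioo (0 : ℝ) 1 := by
      rw [hwx.law_w i]
      exact (prob_compl_eq_zero_iff measurableSet_Ioo).2 hF
    exact ae_of_ae_map (hwx.measurable_w i).aemeasurable this
  -- Eventually at least half the expected number p m of successes occurs, and likewise for the q m
  -- failures of weight at least ε; each of the latter adds at least ε to δ_m.
  refine ⟨min (p / 2) (ε * (q / 2)), by positivity, ?_⟩
  filter_upwards [hwae, ae_all_iff.2 hwx.x_zero_or_one,
    hwx.tendsto_frequency MeasurableSet.univ (Or.inr rfl),
    hwx.tendsto_frequency (measurableSet_Ici (a := ε)) (Or.inl rfl)] with ω hω hx h1 h2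
  refine ⟨hω, fun i => by rcases hx i with h | h <;> simp [h], ?_⟩
  filter_upwards [h1.eventually (lt_mem_nhds (half_lt_self hp)),
    h2.eventually (lt_mem_nhds (half_lt_self hq)), eventually_gt_atTop 0] with m hm1 hm2 hm0
  have hm : (0 : ℝ) < m := Nat.cast_pos.2 hm0
  rw [lt_div_iff₀ hm] at hm1 hm2
  constructor
  · calc min (p / 2) (ε * (q / 2)) * m ≤ p / 2 * m := by gcongr; exact min_le_left _ _
      _ ≤ _ := hm1.le
      _ ≤ _ := by
        unfold successes
        push_cast
        refine Finset.sum_le_sum fun i _ => ?_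
        rcases hx i with h | h <;> simp [h]
  · calc min (p / 2) (ε * (q / 2)) * m ≤ ε * (q / 2 * m) := by
          rw [← mul_assoc]; gcongr; exact min_le_right _ _
      _ ≤ _ := mul_le_mul_of_nonneg_left hm2.le hε.le
      _ ≤ _ := by
        unfold delta
        rw [Finset.mul_sum]
        refine Finset.sum_le_sum fun i _ => ?_
        rcases hx i with h | h
        · by_cases hwi : ε ≤ w i ω
          · simp [h, hwi]
          · simp [h, hwi, (hω i).1.le]
        · simp [h]

end BiasedSampling

/-! ### The Laplace approximation along one realisation. -/

namespace BiasedSampling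

theorem Phi_continuousOn {w : ℕ → ℝ} {x : ℕ → ℕ} {m : ℕ} (hw : ∀ i, 0 < w i)
    (hδ : 0 < delta w x m) : ContinuousOn (Phi w x m) (Ioo 0 1) := by
  have hr : 0 < scaling w x m := (isScalingRoot_scaling hw hδ).pos hδ
  unfold Phi PhiWith
  refine (continuousOn_const.mul (continuousOn_id.rpow_const fun τ hτ => Or.inl hτ.1.ne')).mul ?_
  exact continuousOn_finsetProd _ fun i _ => (continuousOn_const.sub
    (continuousOn_id.rpow_const fun τ hτ => Or.inl hτ.1.ne')).pow _

/-- If `√V (τ - 1/2) = t` and `V → ∞`, then `(V / 4) (log (2 τ))² / 2 → t² / 2`. -/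
theorem tendsto_mul_log_sq {V : ℕ → ℝ} (hV : Tendsto V atTop atTop) (t : ℝ) :
    Tendsto (fun m => V m / 4 * ((-Real.log (1 / 2 + t / √(V m)) - Real.log 2) ^ 2 / 2)) atTop
      (𝓝 (t ^ 2 / 2)) := by
  have hsq := Real.tendsto_sqrt_atTop.comp hV
  -- With ℓ = log (1 + 2t / √V), the quantity is (√V ℓ)² / 8, and √V ℓ → 2t.
  have h1 := (((Real.tendsto_mul_log_one_add_div_atTop (2 * t)).comp hsq).pow 2).div_const 8
  have h0 : Tendsto (fun m => 1 / 2 + t / √(V m)) atTop (𝓝 (1 / 2 + 0)) :=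
    tendsto_const_nhds.add (hsq.const_div_atTop t)
  rw [add_zero] at h0
  have he : (2 * t) ^ 2 / 8 = t ^ 2 / 2 := by ring
  rw [he] at h1
  refine h1.congr' ?_
  filter_upwards [hV.eventually_gt_atTop 0,
    h0.eventually (lt_mem_nhds (show (0 : ℝ) < 1 / 2 by norm_num))] with m hm hpos
  have h2 : 1 + 2 * t / √(V m) = 2 * (1 / 2 + t / √(V m)) := by ring
  simp only [Function.comp_apply]
  rw [h2, Real.log_mul two_ne_zero hpos.ne', mul_pow, Real.sq_sqrt hm.le]
  ring

theorem tendsto_distortion {C : ℝ} {v : ℕ → ℝ} (hv : Tendsto v atTop (𝓝 (Real.log 2))) :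
    Tendsto (fun m => |distortion C (v m) - 1|) atTop (𝓝 0) := by
  have hl := log_two_pos
  have hc : ContinuousAt (distortion C) (Real.log 2) := by
    unfold distortion
    exact (by fun_prop : ContinuousAt (fun v => Real.exp (-(C * (v - Real.log 2)))) _).mul
      ((continuousAt_const.div continuousAt_id hl.ne').pow 2)
  have h1 : distortion C (Real.log 2) = 1 := by
    unfold distortion
    simp [hl.ne']
  have := ((hc.tendsto.comp hv).sub_const 1).abs
  rwa [h1, sub_self, abs_zero] at this

/-- Consistency of the Laplace approximation along a realisation with linear growth. -/
theorem laplace_ratio_tendsto {w : ℕ → ℝ} {x : ℕ → ℕ} (hw : ∀ i, w i ∈ Ioo (0 : ℝ) 1)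
    {C : ℝ} (hδ : ∀ᶠ m in atTop, 0 < delta w x m) (hC : ∀ᶠ m in atTop, scaling w x m ≤ C)
    (hs : Tendsto (fun m => (successes x m : ℝ)) atTop atTop)
    {f : ℕ → ℝ → ℝ} {ε₀ M : ℝ} (hε : 0 < ε₀) (hM : 0 < M)
    (hf : ∀ m, ContDiffOn ℝ 1 (f m) (Ioo 0 1)) (hfε : ∀ m, ε₀ < f m (1 / 2))
    (hfM : ∀ m, ∀ t ∈ Ioo (0 : ℝ) 1, |deriv (f m) t| ≤ M) :
    Tendsto (fun m => (∫ τ in (0 : ℝ)..1, f m τ * Phi w x m τ) / laplaceApprox w x f m)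
      atTop (𝓝 1) := by
  have hw' : ∀ i, 0 < w i := fun i => (hw i).1
  have hl := log_two_pos
  have half_mem : (1 / 2 : ℝ) ∈ Ioo (0 : ℝ) 1 := by norm_num
  set S : ℕ → ℝ := fun m => totalCurvature w x m (scaling w x m) with hS
  set V : ℕ → ℝ := fun m => 4 * S m with hV
  have hVlim : Tendsto V atTop atTop := by
    have hk : 0 < Real.exp (-(C * Real.log 2)) / (Real.log 2) ^ 2 := by positivity
    refine Tendsto.const_mul_atTop four_pos
      (tendsto_atTop_mono' _ ?_ (hs.atTop_mul_const hk))
    filter_upwards [hδ, hC] with m hm hCm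
    exact le_totalCurvature hw ((isScalingRoot_scaling hw' hm).pos hm) hCm
  -- The bounds on f_m enter only here: normalised by its value at 1/2, f_m is Lipschitz uniformly
  -- in m.
  have hfd : ∀ m, ∀ τ ∈ Ioo (0 : ℝ) 1, |f m τ / f m (1 / 2) - 1| ≤ M / ε₀ * |τ - 1 / 2| := by
    intro m τ hτ
    have hpos := hε.trans (hfε m)
    have h1 := Convex.norm_image_sub_le_of_norm_deriv_le (f := f m) (C := M)
      (fun y hy => ((hf m).differentiableOn one_ne_zero).differentiableAt (isOpen_Ioo.mem_nhds hy))
      (fun y hy => hfM m y hy) (convex_Ioo 0 1) half_mem hτ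
    rw [Real.norm_eq_abs, Real.norm_eq_abs] at h1
    have h2 : f m τ / f m (1 / 2) - 1 = (f m τ - f m (1 / 2)) / f m (1 / 2) := by field_simp
    rw [h2, abs_div, abs_of_pos hpos, div_mul_eq_mul_div]
    have := (hfε m).le
    gcongr
  set L : ℕ → ℝ → ℝ := fun m v =>
    ∑ i ∈ Finset.range m, (x i : ℝ) * tangentGap (scaling w x m * w i) v with hL
  set g : ℕ → ℝ → ℝ := fun m τ => f m τ * Phi w x m τ / (f m (1 / 2) * Phi w x m (1 / 2)) with hg
  have hgL : ∀ᶠ m in atTop, ∀ τ ∈ Ioo (0 : ℝ) 1,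
      g m τ = f m τ / f m (1 / 2) * Real.exp (L m (-Real.log τ)) := by
    filter_upwards [hδ] with m hm τ hτ
    have hr := isScalingRoot_scaling hw' hm
    have hp : 0 < Phi w x m (1 / 2) := PhiWith_pos hw' hm (hr.pos hm) half_mem.1 half_mem.2
    have he : Phi w x m τ = Phi w x m (1 / 2) * Real.exp (L m (-Real.log τ)) :=
      PhiWith_eq_mul_exp hw' hm (hr.pos hm) hr.2 hτ.1 hτ.2
    have hpos := hε.trans (hfε m)
    simp only [hg, he]
    field_simp
  have hgauss : Tendsto (fun m => √(V m) * ∫ τ in (0 : ℝ)..1, g m τ) atTop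
      (𝓝 √(2 * Real.pi)) := by
    -- K bounds |f_m(τ) / f_m(1/2)| since |τ - 1/2| ≤ 1; c is the constant e^{-C log 2} / 8 of
    -- `sum_tangentGap_le`, divided by 4 because V = 4 S.
    refine tendsto_sqrt_mul_integral hVlim (K := 1 + M / ε₀)
      (c := Real.exp (-(C * Real.log 2)) / 32) ?_ (by positivity) (by positivity) ?_ ?_
    · filter_upwards [hδ] with m hm
      exact ((hf m).continuousOn.mul (Phi_continuousOn hw' hm)).div_const _
    · filter_upwards [hgL, hδ, hC] with m hm hδm hCm τ hτ
      have hr := isScalingRoot_scaling hw' hδm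
      rw [hm τ hτ, abs_mul, Real.abs_exp]
      have h1 : |f m τ / f m (1 / 2)| ≤ 1 + M / ε₀ := by
        have h2 := hfd m τ hτ
        have h3 : |τ - 1 / 2| ≤ 1 := abs_le.2 ⟨by linarith [hτ.1], by linarith [hτ.2]⟩
        have h4 : M / ε₀ * |τ - 1 / 2| ≤ M / ε₀ := mul_le_of_le_one_right (by positivity) h3
        have h5 := abs_sub_abs_le_abs_sub (f m τ / f m (1 / 2)) 1
        rw [abs_one] at h5
        linarith
      have h2 := sum_tangentGap_le (x := x) (m := m) hw (hr.pos hδm) hCm hτ.1 hτ.2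
      have h3 : -(totalCurvature w x m (scaling w x m)
          * (Real.exp (-(C * Real.log 2)) / 8 * (τ - 1 / 2) ^ 2))
          = -(Real.exp (-(C * Real.log 2)) / 32 * V m * (τ - 1 / 2) ^ 2) := by
        simp only [hV, hS]; ring
      rw [h3] at h2
      gcongr
    · intro t
      have hτ : Tendsto (fun m => 1 / 2 + t / √(V m)) atTop (𝓝 (1 / 2)) := by
        have : Tendsto (fun m => 1 / 2 + t / √(V m)) atTop (𝓝 (1 / 2 + 0)) :=
          tendsto_const_nhds.add ((Real.tendsto_sqrt_atTop.comp hVlim).const_div_atTop t)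
        rwa [add_zero] at this
      have hmem : ∀ᶠ m in atTop, 1 / 2 + t / √(V m) ∈ Ioo (0 : ℝ) 1 :=
        hτ.eventually (Ioo_mem_nhds half_mem.1 half_mem.2)
      have hfl : Tendsto (fun m => f m (1 / 2 + t / √(V m)) / f m (1 / 2)) atTop (𝓝 1) := by
        rw [tendsto_iff_norm_sub_tendsto_zero]
        have hz : Tendsto (fun m => M / ε₀ * |1 / 2 + t / √(V m) - 1 / 2|) atTop (𝓝 0) := by
          have := ((hτ.sub_const (1 / 2)).abs).const_mul (M / ε₀)
          simpa only [sub_self, abs_zero, mul_zero] using this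
        refine squeeze_zero' (Eventually.of_forall fun m => norm_nonneg _) ?_ hz
        filter_upwards [hmem] with m hm
        exact hfd m _ hm
      have hv : Tendsto (fun m => -Real.log (1 / 2 + t / √(V m))) atTop (𝓝 (Real.log 2)) := by
        have := (hτ.log (by norm_num)).neg
        rwa [neg_log_half] at this
      have hquad := tendsto_mul_log_sq hVlim t
      have hLl : Tendsto (fun m => L m (-Real.log (1 / 2 + t / √(V m)))) atTop
          (𝓝 (-(t ^ 2 / 2))) := by
        -- The error is at most |distortion - 1| times the quadratic term; the former tends to 0 and
        -- the latter converges.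
        have hdiff : Tendsto (fun m => L m (-Real.log (1 / 2 + t / √(V m)))
            + V m / 4 * ((-Real.log (1 / 2 + t / √(V m)) - Real.log 2) ^ 2 / 2)) atTop (𝓝 0) := by
          rw [tendsto_zero_iff_norm_tendsto_zero]
          have hz := (tendsto_distortion (C := C) hv).mul hquad
          rw [zero_mul] at hz
          refine squeeze_zero' (Eventually.of_forall fun m => norm_nonneg _) ?_ hz
          filter_upwards [hmem, hδ, hC] with m hm hδm hCm
          have hr := isScalingRoot_scaling hw' hδm
          have h1 := abs_sum_tangentGap_add_le (x := x) (m := m) hw (hr.pos hδm) hCm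
            (neg_log_pos hm.1 hm.2)
          have h2 : V m / 4 = totalCurvature w x m (scaling w x m) := by
            simp only [hV, hS]; ring
          rw [h2, Real.norm_eq_abs]
          exact h1.trans_eq (by ring)
        have := hdiff.sub hquad
        simpa only [add_sub_cancel_right, zero_sub] using this
      have h1 := hfl.mul ((Real.continuous_exp.tendsto _).comp hLl)
      have h2 : 1 * Real.exp (-(t ^ 2 / 2)) = Real.exp (-(1 / 2) * t ^ 2) := by ring_nf
      rw [h2] at h1
      refine h1.congr' ?_
      filter_upwards [hgL, hmem] with m hm hm'
      exact (hm _ hm').symm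
  have hpi : √(2 * Real.pi) ≠ 0 := by positivity
  have hfin := hgauss.div_const √(2 * Real.pi)
  rw [div_self hpi] at hfin
  refine hfin.congr' ?_
  filter_upwards [hδ, hVlim.eventually_gt_atTop 0] with m hm hVm
  have hr := isScalingRoot_scaling hw' hm
  have hd : iteratedDeriv 2 (phi w x m) (1 / 2) = -V m :=
    iteratedDeriv_two_log_PhiWith hw' hm (hr.pos hm) hr.2
  have h1 : -2 * Real.pi / -V m = 2 * Real.pi / V m := by
    rw [neg_mul, neg_div_neg_eq]
  unfold laplaceApprox
  rw [hd, h1, Real.sqrt_div (by positivity)]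
  simp only [hg, intervalIntegral.integral_div]
  have : √(V m) ≠ 0 := (Real.sqrt_pos.2 hVm).ne'
  field_simp

end BiasedSampling

/-! ### Assembly on the almost sure event of linear growth. -/

theorem mainTheorem9 {Ω : Type*} [MeasurableSpace Ω] (P : Measure Ω) [IsProbabilityMeasure P]
    (F : Measure ℝ) (hF : F (Ioo (0 : ℝ) 1) = 1)
    (w : ℕ → Ω → ℝ) (x : ℕ → Ω → ℕ) (hwx : BiasedSampling.IsBernoulliModel P F w x) :
    ∀ᵐ ω ∂P,
      -- both kinds of indicators eventually occur
      (∀ᶠ m in atTop, 0 < BiasedSampling.delta (w · ω) (x · ω) m ∧ 0 < BiasedSampling.successes (x · ω) m) ∧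
      -- `z(h) = φ'(1/2) / (2h)`, and `z` has a unique root in `[1 / δ_m, ∞)`
      (∀ m, 0 < BiasedSampling.delta (w · ω) (x · ω) m →
        (∀ h : ℝ, 0 < h → BiasedSampling.zFun (w · ω) (x · ω) m h =
          deriv (fun τ => Real.log (BiasedSampling.PhiWith (w · ω) (x · ω) m h τ)) (1 / 2) / (2 * h)) ∧
        ∃! h : ℝ, BiasedSampling.IsScalingRoot (w · ω) (x · ω) m h) ∧
      -- `argmax_{[0,1]} Φ_m = 1/2`
      (∀ m, 0 < BiasedSampling.delta (w · ω) (x · ω) m → 0 < BiasedSampling.successes (x · ω) m →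
        {τ ∈ Icc (0 : ℝ) 1 | IsMaxOn (BiasedSampling.Phi (w · ω) (x · ω) m) (Icc 0 1) τ} = {1 / 2}) ∧
      -- consistency of the Laplace approximation
      (∀ (f : ℕ → ℝ → ℝ) (ε₀ M : ℝ), 0 < ε₀ → 0 < M →
        (∀ m, ContDiffOn ℝ 1 (f m) (Ioo 0 1)) →
        (∀ m, ε₀ < f m (1 / 2)) →
        (∀ m, ∀ t ∈ Ioo (0 : ℝ) 1, |deriv (f m) t| ≤ M) →
        Asymptotics.IsEquivalent atTop
          (fun m => ∫ τ in (0 : ℝ)..1, f m τ * BiasedSampling.Phi (w · ω) (x · ω) m τ)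
          (BiasedSampling.laplaceApprox (w · ω) (x · ω) f) ∧
        Tendsto (fun m => (∫ τ in (0 : ℝ)..1, f m τ * BiasedSampling.Phi (w · ω) (x · ω) m τ) /
          BiasedSampling.laplaceApprox (w · ω) (x · ω) f m) atTop (𝓝 1)) := by
  obtain ⟨c, hc, hae⟩ := hwx.ae_linear_growth hF
  filter_upwards [hae] with ω ⟨hw, hx, hgrow⟩
  have hw' : ∀ i, 0 < w i ω := fun i => (hw i).1
  have hlin : Tendsto (fun m : ℕ => c * (m : ℝ)) atTop atTop :=
    tendsto_natCast_atTop_atTop.const_mul_atTop hc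
  have hs : Tendsto (fun m => (BiasedSampling.successes (x · ω) m : ℝ)) atTop atTop :=
    tendsto_atTop_mono' _ (hgrow.mono fun m hm => hm.1) hlin
  have hδ : ∀ᶠ m in atTop, 0 < BiasedSampling.delta (w · ω) (x · ω) m := by
    filter_upwards [hgrow, hlin.eventually_gt_atTop 0] with m hm hpos
    exact hpos.trans_le hm.2
  have hl := BiasedSampling.log_two_pos
  -- Insert 1 ≤ m, s_m ≤ m and δ_m ≥ c m into the explicit bound `scaling_le`.
  have hC : ∀ᶠ m in atTop, BiasedSampling.scaling (w · ω) (x · ω) m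
      ≤ (1 + 1 / Real.log 2) / c := by
    filter_upwards [hgrow, hδ, eventually_ge_atTop 1] with m hm hδm hm1
    have hm1' : (1 : ℝ) ≤ m := by exact_mod_cast hm1
    have hsm : (BiasedSampling.successes (x · ω) m : ℝ) ≤ m := by
      unfold BiasedSampling.successes
      exact_mod_cast (Finset.sum_le_sum fun i _ => hx i).trans_eq (by simp)
    refine (BiasedSampling.scaling_le hw' hδm).trans ?_
    calc _ ≤ ((m : ℝ) + m / Real.log 2) / (c * m) := by
          gcongr
          exact hm.2
      _ = _ := by field_simp
  have hsucc : ∀ᶠ m in atTop, 0 < BiasedSampling.successes (x · ω) m := by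
    filter_upwards [hs.eventually_gt_atTop 0] with m hm
    exact_mod_cast hm
  refine ⟨hδ.and hsucc, fun m hm => ⟨fun h hh => BiasedSampling.zFun_eq_deriv hw' hm hh,
    BiasedSampling.existsUnique_root hw' hm⟩, fun m hm hsm => BiasedSampling.argmax_Phi hw hm hsm,
    fun f ε₀ M hε hM hf hfε hfM => ?_⟩
  have h := BiasedSampling.laplace_ratio_tendsto hw hδ hC hs hε hM hf hfε hfM
  exact ⟨Asymptotics.isEquivalent_of_tendsto_one h, h⟩
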